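/- For $f:\mathbb R^n\to\mathbb R$, consider the assumptions (with $p=2$): AS.1: $f$ is twice continuously differentiable; AS.2: $f$ is bounded below; AS.3: $\nabla^2 f$ is globally Lipschitz continuous; AS.4: there is $\kappa\le 0$ with $\min_{\|d\|\le 1}\nabla^2f(x)[d,d]\ge\kappa$ for all $x$. The simplified OFFAR2 algorithm, given $x_0$, $\sigma_0>0$, $\theta_1\geq 1$ and $\epsilon_1\in(0,1]$, does the following for $k=0,1,2,\dots$. It computes $g_k=\nabla f(x_k)$ and terminates if $\|g_k\|\le\epsilon_1$. Otherwise, if $k>0$, it sets $$\mu_{1,k}=\frac{2\|g_k\|}{\|s_{k-1}\|^2}-\theta_1\sigma_{k-1},\qquad \sigma_k=\max[\sigma_{k-1},\mu_{1,k}].$$ It then computes a step $s_k$ such that $m_k(s_k)<m_k(0)$ and $\|\nabla_s T_k(s_k)\|\le\frac{1}{2}\theta_1\sigma_k\|s_k\|^2$, where $$T_k(s)=f(x_k)+\nabla f(x_k)^Ts+\tfrac12\nabla^2f(x_k)[s,s],\qquad m_k(s)=T_k(s)+\tfrac{\sigma_k}{6}\|s\|^3,$$ and sets $x_{k+1}=x_k+s_k$.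 Theorem. For every $H\ge1$ there are twice continuously differentiable piecewise polynomial functions $f_1,f_2:\mathbb R\to\mathbb R$ satisfying AS.1--AS.4 (with locally finitely many pieces) such that $f(x)=f_1(x_1)+f_2(x_2)$ satisfies AS.1--AS.4 on $\mathbb R^2$ and such that, for every $\theta_1\ge1$ and every $\epsilon_1\in(0,1]$, the sequences $$x_k=k\begin{pmatrix}1\\ \frac1{H+1}\end{pmatrix},\qquad s_k=\begin{pmatrix}1\\ \frac1{H+1}\end{pmatrix},\qquad \sigma_k=\frac{2(H+1)}{\sqrt{1+(H+1)^2}}\qquad(k\ge0)$$ are the iterates, steps and regularization parameters of a never-terminating run of the simplified OFFAR2 algorithm applied to $f$ from $x_0=0$ with $\sigma_0=\frac{2(H+1)}{\sqrt{1+(H+1)^2}}$. In this run each $s_k$ is a global minimizer of $m_k$ and, for all $k\ge0$, $$f(x_k)=1,\qquad \nabla f(x_k)=-\begin{pmatrix}1\\1\end{pmatrix},\qquad \nabla^2f(x_k)=\begin{pmatrix}0&0\\0&H\end{pmatrix},\qquad \|\nabla f(x_k)\|=\sqrt2 .$$ In particular the simplified algorithm may fail to converge. -/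

import Mathlib

open scoped Nat

namespace OFFAR

noncomputable section

variable {E : Type*} [NormedAddCommGroup E] [InnerProductSpace ℝ E]

/-- AS.1: `f` is `p` times continuously differentiable. -/
def AS1 (p : ℕ) (f : E → ℝ) : Prop := ContDiff ℝ p f

/-- AS.2: `f` is bounded below. -/
def AS2 (f : E → ℝ) : Prop := ∃ flow : ℝ, ∀ x, flow ≤ f x

/-- AS.3: the `p`th derivative of `f` is globally Lipschitz continuous. -/
def AS3 (p : ℕ) (f : E → ℝ) : Prop :=
  ∃ L : ℝ, 0 ≤ L ∧ ∀ x y, ‖iteratedFDeriv ℝ p f x - iteratedFDeriv ℝ p f y‖ ≤ L * ‖x - y‖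

/-- AS.4: the forms `d ↦ ∇ⁱ f(x)[d]ⁱ`, `2 ≤ i ≤ p`, are bounded below on the unit ball,
uniformly in `x`. -/
def AS4 (p : ℕ) (f : E → ℝ) : Prop :=
  ∃ κ : ℝ, κ ≤ 0 ∧ ∀ x : E, ∀ i ∈ Finset.Icc 2 p, ∀ d : E, ‖d‖ ≤ 1 →
    κ ≤ iteratedFDeriv ℝ i f x (fun _ => d)

/-- The conjunction of AS.1, AS.2, AS.3 and AS.4. -/
structure Assumptions (p : ℕ) (f : E → ℝ) : Prop where
  as1 : AS1 p f
  as2 : AS2 f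
  as3 : AS3 p f
  as4 : AS4 p f

/-- The Taylor expansion `T_{f,p}(x,s) = f(x) + ∑_{i=1}^p (1/i!) ∇ⁱ f(x)[s]ⁱ`. -/
def taylor (p : ℕ) (f : E → ℝ) (x s : E) : ℝ :=
  f x + ∑ i ∈ Finset.Icc 1 p, (1 / (i ! : ℝ)) * iteratedFDeriv ℝ i f x (fun _ => s)

/-- The regularized model `m(s) = T_{f,p}(x,s) + σ/(p+1)! ‖s‖^{p+1}`. -/
def model (p : ℕ) (f : E → ℝ) (x : E) (σ : ℝ) (s : E) : ℝ :=
  taylor p f x s + σ / ((p + 1)! : ℝ) * ‖s‖ ^ (p + 1)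

variable [CompleteSpace E]

/-- `μ₁ = p! ‖∇f(x)‖ / ‖s‖^p - θ₁ σ`, where `x` is the current iterate and `s`, `σ` are the
previous step and regularization parameter. -/
def mu1 (p : ℕ) (f : E → ℝ) (θ₁ : ℝ) (x s : E) (σ : ℝ) : ℝ :=
  (p ! : ℝ) * ‖gradient f x‖ / ‖s‖ ^ p - θ₁ * σ

/-- The sequences `x`, `s`, `σ` are the iterates, steps and regularization parameters of an
execution that never terminates of the simplified OFFAR`p` algorithm, i.e. the one with the
update `σ_k = max[σ_{k-1}, μ_{1,k}]`, applied to `f` with starting point `x₀`, initial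
regularization parameter `σ₀`, parameter `θ₁` and accuracy `ε₁`. -/
structure IsInfiniteSimplifiedRun (p : ℕ) (f : E → ℝ) (x₀ : E) (σ₀ θ₁ ε₁ : ℝ)
    (x s : ℕ → E) (σ : ℕ → ℝ) : Prop where
  x_zero : x 0 = x₀
  σ_zero : σ 0 = σ₀
  /-- The termination test `‖g_k‖ ≤ ε₁` fails at every iteration. -/
  not_terminated : ∀ k, ¬ ‖gradient f (x k)‖ ≤ ε₁
  σ_update : ∀ k, σ (k + 1) = max (σ k) (mu1 p f θ₁ (x (k + 1)) (s k) (σ k))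
  descent : ∀ k, model p f (x k) (σ k) (s k) - model p f (x k) (σ k) 0 < 0
  grad_step : ∀ k, ‖gradient (taylor p f (x k)) (s k)‖ ≤ θ₁ * (σ k / (p ! : ℝ)) * ‖s k‖ ^ p
  x_update : ∀ k, x (k + 1) = x k + s k

/-- `h` agrees with a polynomial on each interval of some locally finite subdivision of `ℝ`. -/
def IsPiecewisePolynomial (h : ℝ → ℝ) : Prop :=
  ∃ (t : ℤ → ℝ) (P : ℤ → Polynomial ℝ), StrictMono t ∧
    Filter.Tendsto t Filter.atTop Filter.atTop ∧ Filter.Tendsto t Filter.atBot Filter.atBot ∧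
    ∀ i, ∀ y ∈ Set.Icc (t i) (t (i + 1)), h y = (P i).eval y

end

end OFFAR

/-! The run is stationary: if value, gradient and Hessian agree at all iterates, so do the models,
and one step `s` can serve forever. Take `σ` with `σ ‖s‖ = 2`, so that the regularizer has gradient
`(σ / 2) ‖s‖ s = s` at `s`. With gradient `(-1, -1)` and Hessian `diag(0, H)`, stationarity of the
model then reads `s 0 = 1`, `(H + 1) * s 1 = 1`. Global minimality follows from
`cube_regularizer_lower_bound`, which replaces the cubic by a quadratic touching it at `s`. The
parameter never grows: `‖s‖ ≥ 1` gives `2√2 / ‖s‖² ≤ 4 / ‖s‖ = 2σ`, hence `μ₁ ≤ 2σ - θ₁σ ≤ σ`.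

It remains to realize the data on the lattice of iterates. A separable function works, its summands
having periods `1` and `1 / (H + 1)`. Each is the periodic extension of a quintic with equal
derivatives up to order two at both ends of a period (`exists_isTame_isPiecewisePolynomial`);
periodicity supplies all the global bounds. -/

namespace OFFAR

open Polynomial Filter Topology

/-! ### Periodic extension of polynomials -/

section Periodic

/-- The `T`-periodic function whose restriction to `[0, T)` is `t ↦ P (t / T)`. -/
noncomputable def periodize (T : ℝ) (P : ℝ[X]) (t : ℝ) : ℝ := P.eval (Int.fract (t / T))

lemma eval_fract_eq_of_mem_Icc {P : ℝ[X]} (h01 : P.eval 0 = P.eval 1) {n : ℤ} {u : ℝ}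
    (hu : u ∈ Set.Icc (n : ℝ) (n + 1)) : P.eval (Int.fract u) = P.eval (u - n) := by
  rcases hu.2.eq_or_lt with h | h
  · have : u = ((n + 1 : ℤ) : ℝ) := by rw [h]; push_cast; ring
    rw [this, Int.fract_intCast, h01]
    congr 1
    push_cast
    ring
  · rw [Int.fract, Int.floor_eq_iff.2 ⟨hu.1, h⟩]

lemma hasDerivAt_eval_fract {P : ℝ[X]} (h01 : P.eval 0 = P.eval 1)
    (h01' : P.derivative.eval 0 = P.derivative.eval 1) (u : ℝ) :
    HasDerivAt (fun u => P.eval (Int.fract u)) (P.derivative.eval (Int.fract u)) u := by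
  have key : ∀ n : ℤ, HasDerivAt (fun u : ℝ => P.eval (u - n)) (P.derivative.eval (u - n)) u :=
    fun n => by simpa using (P.hasDerivAt (u - n)).comp_sub_const u (n : ℝ)
  have loc : ∀ n : ℤ, u ∈ Set.Icc (n : ℝ) (n + 1) →
      HasDerivWithinAt (fun u => P.eval (Int.fract u)) (P.derivative.eval (Int.fract u))
        (Set.Icc (n : ℝ) (n + 1)) u := fun n hu => by
    rw [eval_fract_eq_of_mem_Icc h01' hu]
    exact (key n).hasDerivWithinAt.congr (fun v hv => eval_fract_eq_of_mem_Icc h01 hv)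
      (eval_fract_eq_of_mem_Icc h01 hu)
  have hr := loc ⌊u⌋ ⟨Int.floor_le u, (Int.lt_floor_add_one u).le⟩
  -- At an integer `u` the interval to the right gives only a one-sided derivative; the interval to
  -- the left supplies the other side.
  rcases (Int.floor_le u).eq_or_lt with h | h
  · have hl := loc (⌊u⌋ - 1) ⟨by push_cast; linarith, by push_cast; linarith⟩
    refine (hl.union hr).hasDerivAt ?_
    refine mem_of_superset (Icc_mem_nhds (a := u - 1) (b := u + 1) (by linarith) (by linarith)) ?_
    intro v hv
    push_cast
    rcases le_total v u with h' | h'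
    · exact Or.inl ⟨by linarith [hv.1], by linarith⟩
    · exact Or.inr ⟨by linarith, by linarith [hv.2]⟩
  · exact hr.hasDerivAt (Icc_mem_nhds h (Int.lt_floor_add_one u))

lemma hasDerivAt_periodize {T : ℝ} {P : ℝ[X]} (h01 : P.eval 0 = P.eval 1)
    (h01' : P.derivative.eval 0 = P.derivative.eval 1) (t : ℝ) :
    HasDerivAt (periodize T P) (periodize T P.derivative t / T) t := by
  have := (hasDerivAt_eval_fract h01 h01' (t / T)).comp t ((hasDerivAt_id t).div_const T)
  rwa [mul_one_div] at this

lemma exists_bound_eval_unitInterval (P : ℝ[X]) :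
    ∃ M : ℝ, 0 ≤ M ∧ ∀ u ∈ Set.Icc (0 : ℝ) 1, |P.eval u| ≤ M := by
  obtain ⟨M, hM⟩ := isCompact_Icc.exists_bound_of_continuousOn
    (s := Set.Icc (0 : ℝ) 1) P.continuous.continuousOn
  exact ⟨M, (norm_nonneg _).trans (hM 0 (by simp)), hM⟩

lemma fract_mem_Icc (u : ℝ) : Int.fract u ∈ Set.Icc (0 : ℝ) 1 :=
  ⟨Int.fract_nonneg u, (Int.fract_lt_one u).le⟩

lemma exists_bound_periodize (T : ℝ) (P : ℝ[X]) :
    ∃ M : ℝ, 0 ≤ M ∧ ∀ t, |periodize T P t| ≤ M := by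
  obtain ⟨M, h0, hM⟩ := exists_bound_eval_unitInterval P
  exact ⟨M, h0, fun t => hM _ (fract_mem_Icc _)⟩

lemma exists_lipschitz_eval_unitInterval (P : ℝ[X]) :
    ∃ K : ℝ, 0 ≤ K ∧ ∀ u ∈ Set.Icc (0 : ℝ) 1, ∀ v ∈ Set.Icc (0 : ℝ) 1,
      |P.eval u - P.eval v| ≤ K * |u - v| := by
  obtain ⟨K, h0, hK⟩ := exists_bound_eval_unitInterval P.derivative
  refine ⟨K, h0, fun u hu v hv => ?_⟩
  exact (convex_Icc (0 : ℝ) 1).norm_image_sub_le_of_norm_hasDerivWithin_le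
    (fun w _ => (P.hasDerivAt w).hasDerivWithinAt) hK hv hu

/-- Points in different unit cells are compared through cell ends, where `P` takes the common value
`P.eval 0 = P.eval 1`; the two partial distances add up to at most `|u - v|`. -/
lemma exists_lipschitz_eval_fract {P : ℝ[X]} (h01 : P.eval 0 = P.eval 1) :
    ∃ K : ℝ, 0 ≤ K ∧ ∀ u v : ℝ,
      |P.eval (Int.fract u) - P.eval (Int.fract v)| ≤ K * |u - v| := by
  obtain ⟨K, h0, hK⟩ := exists_lipschitz_eval_unitInterval P
  refine ⟨K, h0, fun u v => ?_⟩
  wlog huv : u ≤ v generalizing u v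
  · rw [abs_sub_comm, abs_sub_comm u]
    exact this v u (le_of_not_ge huv)
  rcases (Int.floor_mono huv).eq_or_lt with h | h
  · have := hK _ (fract_mem_Icc u) _ (fract_mem_Icc v)
    rwa [show Int.fract u - Int.fract v = u - v by rw [Int.fract, Int.fract, h]; ring] at this
  · have h1 := hK _ (fract_mem_Icc u) 1 (by simp)
    have h2 := hK 0 (by simp) _ (fract_mem_Icc v)
    have h3 : (⌊u⌋ : ℝ) + 1 ≤ ⌊v⌋ := by exact_mod_cast h
    rw [abs_of_nonpos (a := Int.fract u - 1) (by linarith [(fract_mem_Icc u).2])] at h1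
    rw [abs_of_nonpos (a := 0 - Int.fract v) (by linarith [(fract_mem_Icc v).1])] at h2
    have h4 : -(Int.fract u - 1) + -(0 - Int.fract v) ≤ |u - v| := by
      rw [abs_of_nonpos (sub_nonpos.2 huv)]
      linarith [Int.self_sub_floor u, Int.self_sub_floor v]
    calc |P.eval (Int.fract u) - P.eval (Int.fract v)|
        ≤ |P.eval (Int.fract u) - P.eval 1| + |P.eval 0 - P.eval (Int.fract v)| := by
          rw [h01]; exact abs_sub_le _ _ _
      _ ≤ K * (-(Int.fract u - 1) + -(0 - Int.fract v)) := by linarith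
      _ ≤ K * |u - v| := mul_le_mul_of_nonneg_left h4 h0

lemma exists_lipschitz_periodize {T : ℝ} (hT : 0 < T) {P : ℝ[X]} (h01 : P.eval 0 = P.eval 1) :
    ∃ K : ℝ, 0 ≤ K ∧ ∀ t r : ℝ, |periodize T P t - periodize T P r| ≤ K * |t - r| := by
  obtain ⟨K, h0, hK⟩ := exists_lipschitz_eval_fract h01
  refine ⟨K / T, by positivity, fun t r => (hK _ _).trans_eq ?_⟩
  rw [← sub_div, abs_div, abs_of_pos hT]
  ring

lemma isPiecewisePolynomial_periodize {T : ℝ} (hT : 0 < T) {P : ℝ[X]}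
    (h01 : P.eval 0 = P.eval 1) : IsPiecewisePolynomial (periodize T P) := by
  refine ⟨fun i => i * T, fun i => P.comp (C T⁻¹ * X - C (i : ℝ)), ?_, ?_, ?_, ?_⟩
  · exact fun i j hij => mul_lt_mul_of_pos_right (Int.cast_lt.2 hij) hT
  · exact tendsto_intCast_atTop_atTop.atTop_mul_const hT
  · have : Tendsto (fun i : ℤ => (i : ℝ)) atBot atBot := tendsto_intCast_atBot_iff.2 tendsto_id
    exact this.atBot_mul_const hT
  · intro i y hy
    have : y / T ∈ Set.Icc (i : ℝ) (i + 1) :=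
      ⟨(le_div_iff₀ hT).2 hy.1, (div_le_iff₀ hT).2 (by simpa using hy.2)⟩
    rw [periodize, eval_fract_eq_of_mem_Icc h01 this]
    simp [div_eq_inv_mul]

lemma periodize_natCast_mul {T : ℝ} (hT : T ≠ 0) (P : ℝ[X]) (k : ℕ) :
    periodize T P (k * T) = P.eval 0 := by
  rw [periodize, mul_div_cancel_right₀ _ hT, Int.fract_natCast]

end Periodic

/-! ### Assumptions for functions of one linear form -/

section Ridge

variable {E : Type*} [NormedAddCommGroup E] [InnerProductSpace ℝ E]

/-- `ρ` is bounded below and twice differentiable with derivatives `ρ'` and `ρ''`, the latter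
being bounded and Lipschitz continuous. -/
structure IsTame (ρ ρ' ρ'' : ℝ → ℝ) : Prop where
  hasDerivAt : ∀ t, HasDerivAt ρ (ρ' t) t
  hasDerivAt' : ∀ t, HasDerivAt ρ' (ρ'' t) t
  bddBelow : ∃ m, ∀ t, m ≤ ρ t
  bounded : ∃ M, 0 ≤ M ∧ ∀ t, |ρ'' t| ≤ M
  lipschitz : ∃ K, 0 ≤ K ∧ ∀ t r, |ρ'' t - ρ'' r| ≤ K * |t - r|

variable {ρ ρ' ρ'' : ℝ → ℝ}

lemma IsTame.contDiff (h : IsTame ρ ρ' ρ'') : ContDiff ℝ 2 ρ := by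
  have hd : deriv ρ = ρ' := funext fun t => (h.hasDerivAt t).deriv
  have hd' : deriv ρ' = ρ'' := funext fun t => (h.hasDerivAt' t).deriv
  obtain ⟨K, hK, hL⟩ := h.lipschitz
  have hc : Continuous ρ'' :=
    (LipschitzWith.of_dist_le_mul (K := ⟨K, hK⟩) fun t r => by
      rw [Real.dist_eq, Real.dist_eq]
      exact hL t r).continuous
  rw [show (2 : WithTop ℕ∞) = 1 + 1 by norm_num, contDiff_succ_iff_deriv, hd,
    contDiff_one_iff_deriv, hd']
  exact ⟨fun t => (h.hasDerivAt t).differentiableAt, by simp,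
    fun t => (h.hasDerivAt' t).differentiableAt, hc⟩

lemma IsTame.hasFDerivAt_comp (h : IsTame ρ ρ' ρ'') (l : E →L[ℝ] ℝ) (x : E) :
    HasFDerivAt (fun y => ρ (l y)) (ρ' (l x) • l) x :=
  (h.hasDerivAt (l x)).comp_hasFDerivAt x l.hasFDerivAt

lemma IsTame.iteratedFDeriv_one_comp (h : IsTame ρ ρ' ρ'') (l : E →L[ℝ] ℝ) (x : E)
    (m : Fin 1 → E) : iteratedFDeriv ℝ 1 (fun y => ρ (l y)) x m = ρ' (l x) * l (m 0) := by
  rw [iteratedFDeriv_one_apply, (h.hasFDerivAt_comp l x).fderiv]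
  rfl

lemma IsTame.iteratedFDeriv_two_comp (h : IsTame ρ ρ' ρ'') (l : E →L[ℝ] ℝ) (x : E)
    (m : Fin 2 → E) :
    iteratedFDeriv ℝ 2 (fun y => ρ (l y)) x m = ρ'' (l x) * l (m 0) * l (m 1) := by
  have hf : fderiv ℝ (fun y => ρ (l y)) = fun y => ρ' (l y) • l :=
    funext fun y => (h.hasFDerivAt_comp l y).fderiv
  have hd := ((h.hasDerivAt' (l x)).comp_hasFDerivAt x l.hasFDerivAt).smul_const l
  rw [iteratedFDeriv_two_apply, hf]
  erw [hd.fderiv]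
  simp

lemma IsTame.contDiff_comp (h : IsTame ρ ρ' ρ'') (l : E →L[ℝ] ℝ) :
    ContDiff ℝ 2 (fun y => ρ (l y)) := h.contDiff.comp l.contDiff

/-- Taking `l` to be the identity covers the one-variable functions; coordinate projections cover
the summands on the plane. -/
lemma IsTame.assumptions_comp (h : IsTame ρ ρ' ρ'') (l : E →L[ℝ] ℝ) :
    Assumptions 2 (fun y => ρ (l y)) where
  as1 := h.contDiff_comp l
  as2 := h.bddBelow.imp fun _ hm y => hm _
  as3 := by
    obtain ⟨K, hK, hL⟩ := h.lipschitz
    refine ⟨K * ‖l‖ * ‖l‖ * ‖l‖, by positivity, fun x y =>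
      ContinuousMultilinearMap.opNorm_le_bound (by positivity) fun m => ?_⟩
    rw [sub_apply, h.iteratedFDeriv_two_comp,
      h.iteratedFDeriv_two_comp, Fin.prod_univ_two, ← sub_mul, ← sub_mul, norm_mul, norm_mul]
    have h1 : ‖ρ'' (l x) - ρ'' (l y)‖ ≤ K * (‖l‖ * ‖x - y‖) := by
      refine (hL _ _).trans (mul_le_mul_of_nonneg_left ?_ hK)
      rw [← map_sub]
      exact l.le_opNorm _
    calc ‖ρ'' (l x) - ρ'' (l y)‖ * ‖l (m 0)‖ * ‖l (m 1)‖
        ≤ (K * (‖l‖ * ‖x - y‖)) * (‖l‖ * ‖m 0‖) * (‖l‖ * ‖m 1‖) := by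
          gcongr <;> exact l.le_opNorm _
      _ = _ := by ring
  as4 := by
    obtain ⟨M, hM, hB⟩ := h.bounded
    refine ⟨-(M * (‖l‖ * ‖l‖)), by simp only [neg_nonpos]; positivity, fun x i hi d hd => ?_⟩
    obtain rfl : i = 2 := by simpa using hi
    rw [h.iteratedFDeriv_two_comp]
    have h1 : |l d| ≤ ‖l‖ := l.unit_le_opNorm d hd
    have h2 : |ρ'' (l x) * l d * l d| ≤ M * (‖l‖ * ‖l‖) := by
      rw [mul_assoc, abs_mul, abs_mul]
      gcongr
      exact hB _
    exact (abs_le.1 h2).1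

lemma Assumptions.add {f g : E → ℝ} (hf : Assumptions 2 f) (hg : Assumptions 2 g) :
    Assumptions 2 (fun y => f y + g y) := by
  have hadd : ∀ x, iteratedFDeriv ℝ 2 (fun y => f y + g y) x =
      iteratedFDeriv ℝ 2 f x + iteratedFDeriv ℝ 2 g x := fun x =>
    iteratedFDeriv_add_apply (ContDiff.contDiffAt hf.as1) (ContDiff.contDiffAt hg.as1)
  refine ⟨ContDiff.add hf.as1 hg.as1, ?_, ?_, ?_⟩
  · obtain ⟨a, ha⟩ := hf.as2
    obtain ⟨b, hb⟩ := hg.as2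
    exact ⟨a + b, fun y => add_le_add (ha y) (hb y)⟩
  · obtain ⟨K, hK, hf3⟩ := hf.as3
    obtain ⟨L, hL, hg3⟩ := hg.as3
    refine ⟨K + L, by positivity, fun x y => ?_⟩
    rw [hadd, hadd, add_sub_add_comm, add_mul]
    exact norm_add_le_of_le (hf3 x y) (hg3 x y)
  · obtain ⟨a, ha, hf4⟩ := hf.as4
    obtain ⟨b, hb, hg4⟩ := hg.as4
    refine ⟨a + b, by linarith, fun x i hi d hd => ?_⟩
    have h1 := hf4 x i hi d hd
    have h2 := hg4 x i hi d hd
    obtain rfl : i = 2 := by simpa using hi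
    rw [hadd, add_apply]
    exact add_le_add h1 h2

end Ridge

/-! ### Hermite interpolation at the lattice points -/

section Hermite

/-- A quintic taking at both `0` and `1` the value `c`, with first derivative `b` and second
derivative `e`. -/
noncomputable def hermiteQuintic (c b e : ℝ) : ℝ[X] :=
  C c + C b * (X - 10 * X ^ 3 + 15 * X ^ 4 - 6 * X ^ 5) + C (e / 2) * (X ^ 2 - 2 * X ^ 3 + X ^ 4)

lemma derivative_hermiteQuintic (c b e : ℝ) : derivative (hermiteQuintic c b e) =
    C b * (1 - 30 * X ^ 2 + 60 * X ^ 3 - 30 * X ^ 4) +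
      C (e / 2) * (2 * X - 6 * X ^ 2 + 4 * X ^ 3) := by
  simp only [hermiteQuintic, derivative_add, derivative_sub, derivative_mul, derivative_C,
    derivative_X_pow, derivative_X, derivative_ofNat]
  simp only [Nat.cast_ofNat, map_ofNat]
  ring

lemma derivative_derivative_hermiteQuintic (c b e : ℝ) :
    derivative (derivative (hermiteQuintic c b e)) =
    C b * (-60 * X + 180 * X ^ 2 - 120 * X ^ 3) + C (e / 2) * (2 - 12 * X + 12 * X ^ 2) := by
  simp only [derivative_hermiteQuintic, derivative_add, derivative_sub, derivative_mul, derivative_C,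
    derivative_X_pow, derivative_X, derivative_ofNat, derivative_one]
  simp only [Nat.cast_ofNat, map_ofNat]
  ring

lemma eval_hermiteQuintic_zero (c b e : ℝ) :
    (hermiteQuintic c b e).eval 0 = c := by
  simp [hermiteQuintic]

lemma eval_hermiteQuintic_one (c b e : ℝ) :
    (hermiteQuintic c b e).eval 1 = c := by
  simp [hermiteQuintic]; ring

lemma eval_derivative_hermiteQuintic_zero (c b e : ℝ) :
    (hermiteQuintic c b e).derivative.eval 0 = b := by
  simp [derivative_hermiteQuintic]

lemma eval_derivative_hermiteQuintic_one (c b e : ℝ) :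
    (hermiteQuintic c b e).derivative.eval 1 = b := by
  simp [derivative_hermiteQuintic]; ring

lemma eval_derivative_derivative_hermiteQuintic_zero (c b e : ℝ) :
    (hermiteQuintic c b e).derivative.derivative.eval 0 = e := by
  simp [derivative_derivative_hermiteQuintic]

lemma eval_derivative_derivative_hermiteQuintic_one (c b e : ℝ) :
    (hermiteQuintic c b e).derivative.derivative.eval 1 = e := by
  rw [derivative_derivative_hermiteQuintic]
  simp only [eval_add, eval_sub, eval_mul, eval_C, eval_neg, eval_ofNat, eval_X, eval_pow]
  ring

/-- A periodic piecewise polynomial function of class `C²` with prescribed value, first and second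
derivative at the multiples of its period. -/
lemma exists_isTame_isPiecewisePolynomial {T : ℝ} (hT : 0 < T) (c b e : ℝ) :
    ∃ ρ ρ' ρ'' : ℝ → ℝ, IsTame ρ ρ' ρ'' ∧ IsPiecewisePolynomial ρ ∧
      ∀ k : ℕ, ρ (k * T) = c ∧ ρ' (k * T) = b ∧ ρ'' (k * T) = e := by
  -- Each derivative of `P (t / T)` brings a factor `1 / T`, which the prescribed data compensate.
  set P := hermiteQuintic c (b * T) (e * T ^ 2) with hP
  have h0 : P.eval 0 = P.eval 1 := by rw [hP, eval_hermiteQuintic_zero, eval_hermiteQuintic_one]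
  have h1 : P.derivative.eval 0 = P.derivative.eval 1 := by
    rw [hP, eval_derivative_hermiteQuintic_zero, eval_derivative_hermiteQuintic_one]
  have h2 : P.derivative.derivative.eval 0 = P.derivative.derivative.eval 1 := by
    rw [hP, eval_derivative_derivative_hermiteQuintic_zero,
      eval_derivative_derivative_hermiteQuintic_one]
  refine ⟨periodize T P, fun t => periodize T P.derivative t / T,
    fun t => periodize T P.derivative.derivative t / T / T, ⟨?_, ?_, ?_, ?_, ?_⟩,
    isPiecewisePolynomial_periodize hT h0, fun k => ?_⟩
  · exact hasDerivAt_periodize h0 h1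
  · exact fun t => (hasDerivAt_periodize h1 h2 t).div_const T
  · obtain ⟨M, -, hM⟩ := exists_bound_periodize T P
    exact ⟨-M, fun t => (abs_le.1 (hM t)).1⟩
  · obtain ⟨M, hM0, hM⟩ := exists_bound_periodize T P.derivative.derivative
    refine ⟨M / T / T, by positivity, fun t => ?_⟩
    rw [abs_div, abs_div, abs_of_pos hT]
    gcongr
    exact hM t
  · obtain ⟨K, hK0, hK⟩ := exists_lipschitz_periodize hT h2
    refine ⟨K / T / T, by positivity, fun t r => ?_⟩
    rw [← sub_div, ← sub_div, abs_div, abs_div, abs_of_pos hT, div_mul_eq_mul_div,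
      div_mul_eq_mul_div]
    gcongr
    exact hK t r
  · simp only [periodize_natCast_mul hT.ne']
    rw [hP, eval_hermiteQuintic_zero, eval_derivative_hermiteQuintic_zero,
      eval_derivative_derivative_hermiteQuintic_zero]
    refine ⟨rfl, ?_, ?_⟩ <;> field_simp

end Hermite

/-! ### Separable functions on the plane and the cubic regularizer -/

section Plane

local notation "E₂" => EuclideanSpace ℝ (Fin 2)

variable {ρ ρ' ρ'' τ τ' τ'' : ℝ → ℝ}

lemma hasGradientAt_separable {g h : ℝ → ℝ} {x : E₂} {a b : ℝ} (hg : HasDerivAt g a (x 0))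
    (hh : HasDerivAt h b (x 1)) : HasGradientAt (fun y : E₂ => g (y 0) + h (y 1)) (!₂[a, b]) x := by
  rw [hasGradientAt_iff_hasFDerivAt]
  have h0 := hg.comp_hasFDerivAt x (EuclideanSpace.proj (𝕜 := ℝ) (0 : Fin 2)).hasFDerivAt
  have h1 := hh.comp_hasFDerivAt x (EuclideanSpace.proj (𝕜 := ℝ) (1 : Fin 2)).hasFDerivAt
  refine (h0.add h1).congr_fderiv ?_
  ext v
  simp [PiLp.inner_apply, Fin.sum_univ_two, mul_comm]

lemma iteratedFDeriv_one_separable (h : IsTame ρ ρ' ρ'') (k : IsTame τ τ' τ'') (x : E₂)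
    (m : Fin 1 → E₂) : iteratedFDeriv ℝ 1 (fun y : E₂ => ρ (y 0) + τ (y 1)) x m =
      ρ' (x 0) * m 0 0 + τ' (x 1) * m 0 1 := by
  have hadd := iteratedFDeriv_add_apply (i := 1) (x := x)
    ((h.contDiff_comp (EuclideanSpace.proj (𝕜 := ℝ) (0 : Fin 2))).of_le one_le_two).contDiffAt
    ((k.contDiff_comp (EuclideanSpace.proj (𝕜 := ℝ) (1 : Fin 2))).of_le one_le_two).contDiffAt
  have := congrArg (fun A => A m) hadd
  simp only [add_apply, h.iteratedFDeriv_one_comp, k.iteratedFDeriv_one_comp] at this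
  exact this

lemma iteratedFDeriv_two_separable (h : IsTame ρ ρ' ρ'') (k : IsTame τ τ' τ'') (x : E₂)
    (m : Fin 2 → E₂) : iteratedFDeriv ℝ 2 (fun y : E₂ => ρ (y 0) + τ (y 1)) x m =
      ρ'' (x 0) * m 0 0 * m 1 0 + τ'' (x 1) * m 0 1 * m 1 1 := by
  have hadd := iteratedFDeriv_add_apply (i := 2) (x := x)
    (h.contDiff_comp (EuclideanSpace.proj (𝕜 := ℝ) (0 : Fin 2))).contDiffAt
    (k.contDiff_comp (EuclideanSpace.proj (𝕜 := ℝ) (1 : Fin 2))).contDiffAt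
  have := congrArg (fun A => A m) hadd
  simp only [add_apply, h.iteratedFDeriv_two_comp, k.iteratedFDeriv_two_comp] at this
  exact this

lemma taylor_two_separable (h : IsTame ρ ρ' ρ'') (k : IsTame τ τ' τ'') (x s : E₂) :
    taylor 2 (fun y : E₂ => ρ (y 0) + τ (y 1)) x s =
      (ρ (x 0) + ρ' (x 0) * s 0 + ρ'' (x 0) / 2 * s 0 ^ 2) +
        (τ (x 1) + τ' (x 1) * s 1 + τ'' (x 1) / 2 * s 1 ^ 2) := by
  rw [taylor, show Finset.Icc 1 2 = {1, 2} from rfl, Finset.sum_pair (by norm_num),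
    iteratedFDeriv_one_separable h k, iteratedFDeriv_two_separable h k]
  simp only [Nat.factorial]
  push_cast
  ring

lemma norm_sq_eq (v : E₂) : ‖v‖ ^ 2 = v 0 ^ 2 + v 1 ^ 2 := by
  simp [EuclideanSpace.norm_sq_eq, Fin.sum_univ_two]

/-- If `σ ‖s‖ = 2` then `(σ / 6) ‖u‖³` lies above a quadratic that touches it on the sphere
through `s`. -/
lemma cube_regularizer_lower_bound {σ r t : ℝ} (hr : 0 < r) (ht : 0 ≤ t) (hσ : σ * r = 2) :
    σ / 6 * r ^ 3 + (t ^ 2 - r ^ 2) / 2 ≤ σ / 6 * t ^ 3 := by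
  have hσ0 : 0 < σ := by
    by_contra! h
    nlinarith
  -- Tangency makes `r` a double root of the difference; the missing linear term forces the third
  -- root `-r / 2`.
  have h : 0 ≤ σ / 6 * ((t - r) ^ 2 * (t + r / 2)) := by positivity
  have e : σ / 6 * ((t - r) ^ 2 * (t + r / 2)) =
      σ / 6 * t ^ 3 - σ * r / 4 * t ^ 2 + σ * r / 12 * r ^ 2 := by ring
  have e' : σ / 6 * r ^ 3 = σ * r / 6 * r ^ 2 := by ring
  rw [e, hσ] at h
  rw [e', hσ]
  linarith

end Plane
end OFFAR

/-! ### The non-convergent run -/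

open OFFAR in
theorem mainTheorem7 (H : ℝ) (hH : 1 ≤ H) :
    ∃ (f : EuclideanSpace ℝ (Fin 2) → ℝ) (f₁ f₂ : ℝ → ℝ)
      (x s : ℕ → EuclideanSpace ℝ (Fin 2)) (σ : ℕ → ℝ),
      -- the objective function
      OFFAR.Assumptions 2 f ∧
      OFFAR.Assumptions 2 f₁ ∧ OFFAR.IsPiecewisePolynomial f₁ ∧
      OFFAR.Assumptions 2 f₂ ∧ OFFAR.IsPiecewisePolynomial f₂ ∧
      (∀ y, f y = f₁ (y 0) + f₂ (y 1)) ∧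
      -- the sequences
      (∀ k, s k = !₂[1, 1 / (H + 1)]) ∧
      (∀ k, x k = (k : ℝ) • !₂[1, 1 / (H + 1)]) ∧
      (∀ k, σ k = 2 * (H + 1) / √(1 + (H + 1) ^ 2)) ∧
      -- they form an infinite run of the simplified algorithm, with exact model minimization
      (∀ θ₁ : ℝ, 1 ≤ θ₁ → ∀ ε₁ ∈ Set.Ioc (0 : ℝ) 1,
        OFFAR.IsInfiniteSimplifiedRun 2 f 0 (2 * (H + 1) / √(1 + (H + 1) ^ 2)) θ₁ ε₁ x s σ) ∧
      (∀ k, IsMinOn (OFFAR.model 2 f (x k) (σ k)) Set.univ (s k)) ∧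
      -- values, gradients and Hessians at the iterates
      (∀ k, f (x k) = 1) ∧
      (∀ k, gradient f (x k) = !₂[-1, -1]) ∧
      (∀ k u v, iteratedFDeriv ℝ 2 f (x k) ![u, v] = H * u 1 * v 1) ∧
      (∀ k, ‖gradient f (x k)‖ = √2) := by
  have hH1 : 0 < H + 1 := by linarith
  set a : ℝ := 1 / (H + 1) with ha
  have ha0 : 0 < a := by positivity
  have haH : a * (H + 1) = 1 := by rw [ha]; field_simp
  obtain ⟨f₁, f₁', f₁'', ht₁, hp₁, hv₁⟩ := exists_isTame_isPiecewisePolynomial one_pos 1 (-1) 0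
  obtain ⟨f₂, f₂', f₂'', ht₂, hp₂, hv₂⟩ := exists_isTame_isPiecewisePolynomial ha0 0 (-1) H
  set f : EuclideanSpace ℝ (Fin 2) → ℝ := fun y => f₁ (y 0) + f₂ (y 1) with hf
  set s : EuclideanSpace ℝ (Fin 2) := !₂[1, a] with hs
  set x : ℕ → EuclideanSpace ℝ (Fin 2) := fun k => (k : ℝ) • s with hx
  set σ : ℝ := 2 * (H + 1) / √(1 + (H + 1) ^ 2) with hσ
  have s0 : s 0 = 1 := rfl
  have s1 : s 1 = a := rfl
  have x0 : ∀ k, x k 0 = k * 1 := fun k => rfl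
  have x1 : ∀ k, x k 1 = k * a := fun k => rfl
  have hval : ∀ k, f (x k) = 1 := fun k => by
    simp only [hf, x0, x1, hv₁ k, hv₂ k, add_zero]
  have hgrad : ∀ k, gradient f (x k) = !₂[-1, -1] := fun k => by
    have := hasGradientAt_separable (ht₁.hasDerivAt (x k 0)) (ht₂.hasDerivAt (x k 1))
    rw [x0, x1, (hv₁ k).2.1, (hv₂ k).2.1] at this
    exact this.gradient
  have hnorm : ∀ k, ‖gradient f (x k)‖ = √2 := fun k => by
    rw [hgrad, EuclideanSpace.norm_eq, Fin.sum_univ_two]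
    norm_num
  have htaylor : ∀ k, taylor 2 f (x k) = fun y => (-y 0) + (1 - y 1 + H / 2 * y 1 ^ 2) :=
    fun k => funext fun y => by
      rw [hf, taylor_two_separable ht₁ ht₂]
      simp only [x0, x1, hv₁ k, hv₂ k]
      ring
  have hs2 : ‖s‖ ^ 2 = 1 + a ^ 2 := by rw [norm_sq_eq, s0, s1, one_pow]
  have hspos : 0 < ‖s‖ := by
    rw [norm_pos_iff]
    intro h
    exact one_ne_zero (s0.symm.trans (by rw [h]; rfl))
  have hs1 : 1 ≤ ‖s‖ := by nlinarith
  have hsσ : σ * ‖s‖ = 2 := by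
    have h : √(1 + (H + 1) ^ 2) = (H + 1) * ‖s‖ := by
      rw [Real.sqrt_eq_iff_mul_self_eq (by positivity) (by positivity)]
      calc 1 + (H + 1) ^ 2 = (H + 1) ^ 2 + (a * (H + 1)) ^ 2 := by rw [haH]; ring
        _ = (H + 1) ^ 2 * ‖s‖ ^ 2 := by rw [hs2]; ring
        _ = (H + 1) * ‖s‖ * ((H + 1) * ‖s‖) := by ring
    rw [hσ, h]
    field_simp
  have hσpos : 0 < σ := by positivity
  have hmodel : ∀ k y, model 2 f (x k) σ y =
      -y 0 + (1 - y 1 + H / 2 * y 1 ^ 2) + σ / 6 * ‖y‖ ^ 3 := fun k y => by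
    rw [model, htaylor]
    norm_num [Nat.factorial]
  have hHa : H * a = 1 - a := by linarith
  refine ⟨f, f₁, f₂, x, fun _ => s, fun _ => σ,
    (ht₁.assumptions_comp (EuclideanSpace.proj (𝕜 := ℝ) (0 : Fin 2))).add
      (ht₂.assumptions_comp (EuclideanSpace.proj (𝕜 := ℝ) (1 : Fin 2))),
    ht₁.assumptions_comp (ContinuousLinearMap.id ℝ ℝ), hp₁,
    ht₂.assumptions_comp (ContinuousLinearMap.id ℝ ℝ), hp₂, fun _ => rfl, fun _ => rfl,
    fun _ => rfl, fun _ => rfl, ?_, ?_, hval, hgrad, ?_, hnorm⟩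
  · intro θ₁ hθ ε₁ hε
    refine ⟨by simp [hx], rfl, fun k => ?_, fun k => ?_, fun k => ?_, fun k => ?_, fun k => ?_⟩
    · rw [hnorm, not_le]
      exact hε.2.trans_lt (Real.one_lt_sqrt_two)
    · refine (max_eq_left ?_).symm
      rw [mu1, hnorm]
      have h2 : √2 ≤ 2 := by
        rw [Real.sqrt_le_left (by norm_num)]; norm_num
      have h3 : ((2).factorial : ℝ) * √2 / ‖s‖ ^ 2 ≤ 2 * σ := by
        rw [div_le_iff₀ (by positivity)]
        have : 2 * σ * ‖s‖ ^ 2 = 4 * ‖s‖ := by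
          rw [show 2 * σ * ‖s‖ ^ 2 = 2 * (σ * ‖s‖) * ‖s‖ by ring, hsσ]; ring
        rw [this]
        norm_num [Nat.factorial]
        linarith
      have h4 : σ ≤ θ₁ * σ := le_mul_of_one_le_left hσpos.le hθ
      linarith
    -- The decrease equals `-2/3 - a/2 - a²/6`.
    · rw [hmodel, hmodel, s0, s1, norm_zero]
      have h3 : σ / 6 * ‖s‖ ^ 3 = (1 + a ^ 2) / 3 := by
        rw [show σ / 6 * ‖s‖ ^ 3 = (σ * ‖s‖) / 6 * ‖s‖ ^ 2 by ring, hsσ, hs2]; ring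
      rw [h3]
      have ha1 : a < 1 := by nlinarith
      have : H / 2 * a ^ 2 = (1 - a) * a / 2 := by rw [← hHa]; ring
      rw [this]
      simp only [PiLp.zero_apply]
      nlinarith
    -- Since `s` is stationary for the model, the Taylor gradient cancels the regularizer's gradient
    -- `s`; the allowed bound is `θ₁ ‖s‖`.
    · have hg : HasGradientAt (taylor 2 f (x k)) (-s) s := by
        rw [htaylor]
        have hd : HasDerivAt (fun t => 1 - t + H / 2 * t ^ 2) (-a) (s 1) := by
          refine (((hasDerivAt_id' (s 1)).const_sub 1).add
            ((hasDerivAt_pow 2 (s 1)).const_mul (H / 2))).congr_deriv ?_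
          rw [s1]
          norm_num
          linarith
        have hv : -s = !₂[-1, -a] := by
          ext i
          fin_cases i <;> rfl
        rw [hv]
        exact hasGradientAt_separable (hasDerivAt_neg (s 0)) hd
      rw [hg.gradient, norm_neg]
      have : θ₁ * (σ / ((2).factorial : ℝ)) * ‖s‖ ^ 2 = θ₁ * ‖s‖ := by
        rw [Nat.factorial_two, Nat.cast_ofNat]
        linear_combination θ₁ * ‖s‖ / 2 * hsσ
      rw [this]
      exact le_mul_of_one_le_left hspos.le hθ
    · simp only [hx]
      push_cast
      rw [add_smul, one_smul]
  · intro k y _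
    change model 2 f (x k) σ s ≤ model 2 f (x k) σ y
    rw [hmodel, hmodel, s0, s1]
    have hc := cube_regularizer_lower_bound hspos (norm_nonneg y) hsσ
    rw [norm_sq_eq y, hs2] at hc
    -- This is the quadratic minorant of the model at `y` minus the model value at `s`, with squares
    -- completed.
    have hq : 0 ≤ (y 0 - 1) ^ 2 / 2 + (H + 1) / 2 * (y 1 - a) ^ 2 := by positivity
    have e : (H + 1) / 2 * (y 1 - a) ^ 2 =
        (H + 1) / 2 * y 1 ^ 2 - a * (H + 1) * y 1 + (H + 1) / 2 * a ^ 2 := by ring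
    have e' : (H + 1) / 2 * a ^ 2 = a * (H + 1) * a / 2 := by ring
    have e'' : H / 2 * a ^ 2 = (H * a) * a / 2 := by ring
    rw [e, e', haH] at hq
    rw [e'', hHa]
    linarith
  · intro k u v
    rw [hf, iteratedFDeriv_two_separable ht₁ ht₂, x0, x1, (hv₁ k).2.2, (hv₂ k).2.2]
    simp
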